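/- Let $\Sigma$ be a finitely aligned $k$-graph, i.e. a countable small category with a degree functor $d:\Sigma\to\mathbb{N}^k$ satisfying the factorisation property, such that for all paths $\mu,\nu\in\Sigma$ the set $\Sigma^{\min}(\mu,\nu)=\{(\alpha,\beta):\mu\alpha=\nu\beta,\ d(\mu\alpha)=d(\mu)\vee d(\nu)\}$ is finite. Let $C^*(\Sigma)$ be its Cuntz–Krieger algebra, generated by the universal Cuntz–Krieger family $\{s_\lambda:\lambda\in\Sigma\}$, and let $\gamma$ be the gauge action of $\mathbb{T}^k$, so $\gamma_z(s_\lambda)=z^{d(\lambda)}s_\lambda$. For a vertex $v$ and a finite set $E\subseteq v\Sigma$ put $\Delta(s)^E:=\prod_{\lambda\in E}(s_v-s_\lambda s_\lambda^*)$. For a $k$-graph $\Gamma$ let $\mathrm{FE}(\Gamma)$ be the collection of finite sets $E\subseteq v\Gamma\setminus\{v\}$, $v\in\Gamma^0$, that are exhaustive in $\Gamma$: for each $\mu\in v\Gamma$ there is $\nu\in E$ with $\Gamma^{\min}(\mu,\nu)\neq\emptyset$. Ideals of $C^*$-algebras are closed and two-sided. Let $I$ be a gauge-invariant ideal of $C^*(\Sigma)$,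 let $H_I:=\{v\in\Sigma^0:s_v\in I\}$, let $\Sigma\setminus\Sigma H_I:=\{\lambda\in\Sigma:s(\lambda)\notin H_I\}$ (a sub-$k$-graph, where $s(\lambda)$ is the source of $\lambda$), and let $$B_I:=\{E\in\mathrm{FE}(\Sigma\setminus\Sigma H_I):\Delta(s)^E\in I\},\qquad \tilde B_I:=\Big\{E\in B_I:E\subseteq\bigcup_{j=1}^k\Sigma^{e_j}\Big\},$$ where $\Sigma^{e_j}$ is the set of paths whose degree is the $j$th generator $e_j$ of $\mathbb{N}^k$. Let $J$ be the ideal of $C^*(\Sigma)$ generated by $\{\Delta(s)^E:E\in\tilde B_I\}$. Then $\Delta(s)^E\in J$ for every $E\in B_I$. Consequently the sets $\{s_v:v\in H_I\}\cup\{\Delta(s)^E:E\in B_I\}$ and $\{s_v:v\in H_I\}\cup\{\Delta(s)^E:E\in\tilde B_I\}$ generate the same ideal of $C^*(\Sigma)$. -/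

import Mathlib

open CategoryTheory
open scoped ENNReal

universe u w v v'

namespace KGraphAlgebra

/-! ### Higher-rank graphs

A path `lam` of the `k`-graph is a morphism `lam : x ⟶ y`; its source `s(lam)` is the domain `x`
and its range `r(lam)` is the codomain `y`. The product `μν = μ ∘ ν` (with `s(μ) = r(ν)`) is
`ν ≫ μ` in Mathlib's notation. -/

/-- A `k`-graph: a countable small category with a degree functor to `ℕ^k` that has the
factorisation property. -/
class KGraph (k : outParam ℕ) (Λ : Type u) [Category.{w} Λ] where
  /-- the degree functor -/
  deg : ∀ {x y : Λ}, (x ⟶ y) → (Fin k → ℕ)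
  deg_id : ∀ x : Λ, deg (𝟙 x) = 0
  deg_comp : ∀ {x y z : Λ} (ν : x ⟶ y) (μ : y ⟶ z), deg (ν ≫ μ) = deg μ + deg ν
  factorisation : ∀ {x z : Λ} (lam : x ⟶ z) (m n : Fin k → ℕ), deg lam = m + n →
    ∃! p : (y : Λ) × (x ⟶ y) × (y ⟶ z),
      deg p.2.2 = m ∧ deg p.2.1 = n ∧ p.2.1 ≫ p.2.2 = lam
  countable_obj : Countable Λ
  countable_hom : ∀ x y : Λ, Countable (x ⟶ y)

section Graph

variable {k : ℕ} {Λ : Type u} [Category.{w} Λ] [KGraph k Λ]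

/-- `vΛ`: the paths with range `v`, each bundled with its source. -/
abbrev PathsTo (v : Λ) : Type (max u w) := (x : Λ) × (x ⟶ v)

/-- `Λ^min(μ, ν)` for two paths with the same range: the pairs `(α, β)` (bundled with their common
source) such that `μα = νβ` has degree `d(μ) ∨ d(ν)`. For paths with different ranges there are no
such pairs. -/
def minExt {a x y : Λ} (μ : x ⟶ a) (ν : y ⟶ a) : Set ((z : Λ) × (z ⟶ x) × (z ⟶ y)) :=
  {p | p.2.1 ≫ μ = p.2.2 ≫ ν ∧ KGraph.deg (p.2.1 ≫ μ) = KGraph.deg μ ⊔ KGraph.deg ν}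

variable (Λ) in
/-- `Λ` is finitely aligned. -/
class FinitelyAligned : Prop where
  finite_minExt : ∀ {a x y : Λ} (μ : x ⟶ a) (ν : y ⟶ a), (minExt μ ν).Finite

/-- `E ∈ v FE(Λ \ ΛH)`, where `Λ \ ΛH` consists of the paths whose source is not in the set `H` of
vertices. This is used for hereditary `H`, where `Λ \ ΛH` is a `k`-graph with vertex set
`Λ⁰ \ H`; for `H = ∅` it says `E ∈ v FE(Λ)`. A pair `(α, β)` of `Λ^min(μ, ν)` consists of paths of
`Λ \ ΛH` precisely when the common source of `α` and `β` is not in `H`. -/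
structure IsFE (H : Set Λ) (v : Λ) (E : Finset (PathsTo v)) : Prop where
  vertex_notMem : v ∉ H
  source_notMem : ∀ lam ∈ E, lam.1 ∉ H
  id_notMem : (⟨v, 𝟙 v⟩ : PathsTo v) ∉ E
  exhaustive : ∀ μ : PathsTo v, μ.1 ∉ H → ∃ ν ∈ E, ∃ p ∈ minExt μ.2 ν.2, p.1 ∉ H

/-- `λ ∈ ⋃ⱼ Λ^{eⱼ}`: the path is an edge. -/
def IsEdge {x y : Λ} (lam : x ⟶ y) : Prop :=
  ∃ j : Fin k, KGraph.deg lam = Pi.single j 1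

lemma eq_id_of_deg_eq_zero {x y : Λ} (f : x ⟶ y) (hf : KGraph.deg f = 0) :
    (⟨x, f⟩ : PathsTo y) = ⟨y, 𝟙 y⟩ := by
  obtain ⟨p, -, hp⟩ := KGraph.factorisation f 0 0 (by simpa using hf)
  have h1 := hp ⟨y, f, 𝟙 y⟩ ⟨KGraph.deg_id _, hf, by simp⟩
  have h2 := hp ⟨x, 𝟙 x, f⟩ ⟨hf, KGraph.deg_id _, by simp⟩
  have h := h2.trans h1.symm
  have := congrArg (fun q : (z : Λ) × (x ⟶ z) × (z ⟶ y) => (⟨q.1, q.2.2⟩ : PathsTo y)) h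
  simpa using this

lemma minExt_self {x y : Λ} (f : x ⟶ y) : minExt f f = {⟨x, 𝟙 x, 𝟙 x⟩} := by
  ext ⟨z, α, β⟩
  simp only [minExt, Set.mem_ofPred_eq, sup_idem, Set.mem_singleton_iff]
  constructor
  · rintro ⟨h1, h2⟩
    have h3 := h2
    rw [h1, KGraph.deg_comp] at h3
    rw [KGraph.deg_comp] at h2
    have hα := eq_id_of_deg_eq_zero α (by simpa using h2)
    have hβ := eq_id_of_deg_eq_zero β (by simpa using h3)
    cases hα
    obtain ⟨-, hβ'⟩ := Sigma.mk.inj hβ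
    cases hβ'
    rfl
  · intro h
    cases h
    simp

end Graph

/-! ### Toeplitz–Cuntz–Krieger and Cuntz–Krieger families -/

/-- A family of elements of `A` indexed by the paths of `Λ`. -/
abbrev PathFamily (Λ : Type u) [Category.{w} Λ] (A : Type v) : Type (max u w v) :=
  ∀ ⦃x y : Λ⦄, (x ⟶ y) → A

section Families

variable {k : ℕ} {Λ : Type u} [Category.{w} Λ] [KGraph k Λ]
variable {A : Type v} [NonUnitalCStarAlgebra A] {B : Type v'} [NonUnitalCStarAlgebra B]

/-- Toeplitz–Cuntz–Krieger `Λ`-families. The last two fields are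
`q_μ^* q_ν = ∑_{(α, β) ∈ Λ^min(μ, ν)} q_α q_β^*`, for `r(μ) = r(ν)` and for `r(μ) ≠ r(ν)` (where the
sum is empty). -/
structure IsTCK (q : PathFamily Λ A) : Prop where
  isStarProjection : ∀ v : Λ, IsStarProjection (q (𝟙 v))
  orthogonal : ∀ v v' : Λ, v ≠ v' → q (𝟙 v) * q (𝟙 v') = 0
  mul : ∀ {x y z : Λ} (μ : y ⟶ z) (ν : x ⟶ y), q μ * q ν = q (ν ≫ μ)
  tck3 : ∀ {a x y : Λ} (μ : x ⟶ a) (ν : y ⟶ a),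
    star (q μ) * q ν = ∑ᶠ p ∈ minExt μ ν, q p.2.1 * star (q p.2.2)
  tck3_of_ne : ∀ {a b x y : Λ} (μ : x ⟶ a) (ν : y ⟶ b), a ≠ b → star (q μ) * q ν = 0

/-- `Δ(q)^E = ∏_{λ ∈ E} (q_v - q_λ q_λ^*)`, the unit `q_v` of the corner being used as the empty
product. The factors commute, so the order of the factors does not matter: see
`foldr_eq_Delta`. -/
noncomputable def Delta (q : PathFamily Λ A) (v : Λ) (E : Finset (PathsTo v)) : A :=
  E.toList.foldr (fun lam a => (q (𝟙 v) - q lam.2 * star (q lam.2)) * a) (q (𝟙 v))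

/-- Cuntz–Krieger `Λ`-families. -/
structure IsCK (q : PathFamily Λ A) : Prop extends IsTCK q where
  ck : ∀ (v : Λ) (E : Finset (PathsTo v)), IsFE ∅ v E → Delta q v E = 0

lemma IsTCK.star_mul_self {q : PathFamily Λ A} (hq : IsTCK q) {x y : Λ} (f : x ⟶ y) :
    star (q f) * q f = q (𝟙 x) := by
  rw [hq.tck3, minExt_self, finsum_mem_singleton, (hq.isStarProjection x).2.star_eq,
    (hq.isStarProjection x).1.eq]

lemma IsTCK.norm_le_one {q : PathFamily Λ A} (hq : IsTCK q) {x y : Λ} (f : x ⟶ y) :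
    ‖q f‖ ≤ 1 := by
  have h : ‖q f‖ * ‖q f‖ ≤ 1 := by
    rw [← CStarRing.norm_star_mul_self, hq.star_mul_self]
    exact IsStarProjection.norm_le _ (hq.isStarProjection x)
  nlinarith [norm_nonneg (q f)]

/-- The range projections of paths with the same range commute. -/
lemma IsTCK.commute [FinitelyAligned Λ] {q : PathFamily Λ A} (hq : IsTCK q) {a x y : Λ}
    (μ : x ⟶ a) (ν : y ⟶ a) : Commute (q μ * star (q μ)) (q ν * star (q ν)) := by
  have key : (q μ * star (q μ)) * (q ν * star (q ν)) =
      ∑ᶠ p ∈ minExt μ ν, q (p.2.1 ≫ μ) * star (q (p.2.1 ≫ μ)) := by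
    have hfin : (minExt μ ν).Finite := FinitelyAligned.finite_minExt μ ν
    calc (q μ * star (q μ)) * (q ν * star (q ν))
        = q μ * (star (q μ) * q ν) * star (q ν) := by simp only [mul_assoc]
      _ = _ := by
        rw [hq.tck3, finsum_mem_eq_finite_toFinset_sum _ hfin,
          finsum_mem_eq_finite_toFinset_sum _ hfin, Finset.mul_sum, Finset.sum_mul]
        refine Finset.sum_congr rfl fun p hp => ?_
        have hp' := ((Set.Finite.mem_toFinset hfin).1 hp).1
        rw [← mul_assoc, hq.mul, mul_assoc, ← StarMul.star_mul, hq.mul, hp']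
  have hs : star ((q μ * star (q μ)) * (q ν * star (q ν))) =
      (q μ * star (q μ)) * (q ν * star (q ν)) := by
    have hfin : (minExt μ ν).Finite := FinitelyAligned.finite_minExt μ ν
    rw [key, finsum_mem_eq_finite_toFinset_sum _ hfin, star_sum]
    simp
  have hs' : star ((q μ * star (q μ)) * (q ν * star (q ν))) =
      (q ν * star (q ν)) * (q μ * star (q μ)) := by simp [mul_assoc]
  exact hs.symm.trans hs'

/-- `Δ(q)^E` may be computed by multiplying the factors in any order. -/
lemma foldr_eq_Delta [FinitelyAligned Λ] {q : PathFamily Λ A} (hq : IsTCK q) (v : Λ)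
    (E : Finset (PathsTo v)) (l : List (PathsTo v)) (hl : l.Perm E.toList) :
    l.foldr (fun lam a => (q (𝟙 v) - q lam.2 * star (q lam.2)) * a) (q (𝟙 v)) = Delta q v E := by
  refine hl.foldr_eq' (fun lam _ μ _ a => ?_) _
  have h1 : ∀ lam : PathsTo v, q (𝟙 v) * q lam.2 = q lam.2 := fun lam => by
    rw [hq.mul, Category.comp_id]
  have h2 : ∀ lam : PathsTo v, star (q lam.2) * q (𝟙 v) = star (q lam.2) := fun lam => by
    have := congrArg star (h1 lam)
    rwa [StarMul.star_mul, (hq.isStarProjection v).2.star_eq] at this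
  have hc := (hq.commute lam.2 μ.2).eq
  have : Commute (q (𝟙 v) - q lam.2 * star (q lam.2)) (q (𝟙 v) - q μ.2 * star (q μ.2)) := by
    show _ = _
    rw [sub_mul, mul_sub, mul_sub, sub_mul, mul_sub, mul_sub, hc, ← mul_assoc (q (𝟙 v)), h1,
      ← mul_assoc (q (𝟙 v)), h1, mul_assoc _ _ (q (𝟙 v)), h2, mul_assoc _ _ (q (𝟙 v)), h2]
    abel
  rw [← mul_assoc, ← mul_assoc, this.eq]

lemma map_Delta (φ : A →⋆ₙₐ[ℂ] B) (q : PathFamily Λ A) (v : Λ) (E : Finset (PathsTo v)) :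
    φ (Delta q v E) = Delta (fun _ _ f => φ (q f)) v E := by
  unfold Delta
  induction E.toList with
  | nil => rfl
  | cons lam l ih => simp [ih, map_star]

lemma map_star_mul_sum [FinitelyAligned Λ] (φ : A →⋆ₙₐ[ℂ] B) (q : PathFamily Λ A) {a x y : Λ}
    (μ : x ⟶ a) (ν : y ⟶ a) :
    φ (∑ᶠ p ∈ minExt μ ν, q p.2.1 * star (q p.2.2)) =
      ∑ᶠ p ∈ minExt μ ν, φ (q p.2.1) * star (φ (q p.2.2)) := by
  have hfin : (minExt μ ν).Finite := FinitelyAligned.finite_minExt μ ν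
  rw [finsum_mem_eq_finite_toFinset_sum _ hfin, finsum_mem_eq_finite_toFinset_sum _ hfin, map_sum]
  simp [map_star]

/-- A family is Cuntz–Krieger if its images under a jointly injective collection of
`*`-homomorphisms are. -/
lemma IsCK.of_jointly_injective [FinitelyAligned Λ] {ι : Type*} {C : ι → Type v'}
    [∀ i, NonUnitalCStarAlgebra (C i)] (φ : ∀ i, A →⋆ₙₐ[ℂ] C i)
    (hφ : ∀ a b : A, (∀ i, φ i a = φ i b) → a = b) (q : PathFamily Λ A)
    (h : ∀ i, IsCK (Λ := Λ) (fun _ _ f => φ i (q f))) : IsCK q where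
  isStarProjection v := by
    refine ⟨hφ _ _ fun i => ?_, hφ _ _ fun i => ?_⟩
    · simpa using ((h i).isStarProjection v).1.eq
    · simpa [map_star] using ((h i).isStarProjection v).2.star_eq
  orthogonal v v' hv := hφ _ _ fun i => by simpa using (h i).orthogonal v v' hv
  mul μ ν := hφ _ _ fun i => by simpa using (h i).mul μ ν
  tck3 μ ν := hφ _ _ fun i => by
    rw [map_star_mul_sum, map_mul, map_star]
    exact (h i).tck3 μ ν
  tck3_of_ne μ ν hab := hφ _ _ fun i => by
    simpa [map_star] using (h i).tck3_of_ne μ ν hab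
  ck v E hE := hφ _ _ fun i => by
    rw [map_Delta, map_zero]
    exact (h i).ck v E hE

/-! ### Twisting a family by the torus -/

/-- `z^n = ∏ᵢ zᵢ^{nᵢ}` for `z ∈ 𝕋^k` and `n ∈ ℕ^k`. -/
noncomputable def torusPow (z : Fin k → Circle) (n : Fin k → ℕ) : Circle := ∏ i, z i ^ n i

lemma torusPow_zero (z : Fin k → Circle) : torusPow z 0 = 1 := by simp [torusPow]

lemma torusPow_add (z : Fin k → Circle) (m n : Fin k → ℕ) :
    torusPow z (m + n) = torusPow z m * torusPow z n := by
  simp [torusPow, pow_add, Finset.prod_mul_distrib]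

/-- The family `z^{d(λ)} q_λ`. -/
noncomputable def twist (z : Fin k → Circle) (q : PathFamily Λ A) : PathFamily Λ A :=
  fun _ _ f => (torusPow z (KGraph.deg f) : ℂ) • q f

lemma circle_conj_mul (c : Circle) : (starRingEnd ℂ) (c : ℂ) * c = 1 := by
  rw [← Complex.normSq_eq_conj_mul_self]; simp

lemma twist_id (z : Fin k → Circle) (q : PathFamily Λ A) (v : Λ) :
    twist z q (𝟙 v) = q (𝟙 v) := by
  simp [twist, KGraph.deg_id, torusPow_zero]

lemma twist_mul_star (z : Fin k → Circle) (q : PathFamily Λ A) {x y : Λ} (f : x ⟶ y) :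
    twist z q f * star (twist z q f) = q f * star (q f) := by
  simp only [twist, star_smul, smul_mul_assoc, mul_smul_comm, smul_smul]
  rw [RCLike.star_def, circle_conj_mul, one_smul]

lemma Delta_twist (z : Fin k → Circle) (q : PathFamily Λ A) (v : Λ) (E : Finset (PathsTo v)) :
    Delta (twist z q) v E = Delta q v E := by
  simp only [Delta, twist_id, twist_mul_star]

lemma IsCK.twist [FinitelyAligned Λ] {q : PathFamily Λ A} (hq : IsCK q) (z : Fin k → Circle) :
    IsCK (twist z q) where
  isStarProjection v := by rw [twist_id]; exact hq.isStarProjection v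
  orthogonal v v' h := by rw [twist_id, twist_id]; exact hq.orthogonal v v' h
  mul μ ν := by
    simp only [KGraphAlgebra.twist, smul_mul_assoc, mul_smul_comm, smul_smul, hq.mul,
      KGraph.deg_comp, torusPow_add, Circle.coe_mul]
    rw [mul_comm]
  tck3 μ ν := by
    have hfin : (minExt μ ν).Finite := FinitelyAligned.finite_minExt μ ν
    rw [finsum_mem_eq_finite_toFinset_sum _ hfin]
    simp only [KGraphAlgebra.twist, star_smul, smul_mul_assoc, mul_smul_comm, smul_smul]
    rw [hq.tck3, finsum_mem_eq_finite_toFinset_sum _ hfin, Finset.smul_sum]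
    refine Finset.sum_congr rfl fun p hp => ?_
    congr 1
    obtain ⟨h, -⟩ := (Set.Finite.mem_toFinset hfin).1 hp
    have h' : (torusPow z (KGraph.deg μ) * torusPow z (KGraph.deg p.2.1) : ℂ) =
        torusPow z (KGraph.deg ν) * torusPow z (KGraph.deg p.2.2) := by
      rw [← Circle.coe_mul, ← Circle.coe_mul, ← torusPow_add, ← torusPow_add, ← KGraph.deg_comp,
        ← KGraph.deg_comp, h]
    have e1 := circle_conj_mul (torusPow z (KGraph.deg μ))
    have e2 := circle_conj_mul (torusPow z (KGraph.deg p.2.2))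
    simp only [RCLike.star_def]
    linear_combination ((torusPow z (KGraph.deg p.2.1) : ℂ) *
      (starRingEnd ℂ) (torusPow z (KGraph.deg p.2.2) : ℂ)) * e1 -
      ((starRingEnd ℂ) (torusPow z (KGraph.deg μ) : ℂ) *
      (starRingEnd ℂ) (torusPow z (KGraph.deg p.2.2) : ℂ)) * h' -
      ((starRingEnd ℂ) (torusPow z (KGraph.deg μ) : ℂ) * (torusPow z (KGraph.deg ν) : ℂ)) * e2
  tck3_of_ne μ ν h := by
    simp [KGraphAlgebra.twist, smul_mul_assoc, mul_smul_comm, hq.tck3_of_ne μ ν h]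
  ck v E hE := by rw [Delta_twist]; exact hq.ck v E hE

end Families

/-! ### The Cuntz–Krieger algebra

`C*(Λ)` is built as the closed `*`-subalgebra, generated by the canonical family, of the
`ℓ^∞`-product over all Cuntz–Krieger `Λ`-families in C⋆-algebras of an arbitrary universe `v`.
It is a C⋆-algebra, the canonical family in it is Cuntz–Krieger (`isCK_ckFamily`) and generates it
(`adjoin_ckFamily`), and it is universal for families in C⋆-algebras of the universe `v` (`ckLift`).
As `Λ` is countable, `C*(Λ)` is separable and does not depend on `v` up to isomorphism. -/

/-- A Cuntz–Krieger `Λ`-family in some C⋆-algebra. -/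
structure CKRep (k : outParam ℕ) (Λ : Type u) [Category.{w} Λ] [KGraph k Λ] :
    Type (max u w (v + 1)) where
  /-- the C⋆-algebra -/
  carrier : Type v
  [inst : NonUnitalCStarAlgebra carrier]
  /-- the family -/
  family : PathFamily Λ carrier
  isCK : IsCK (Λ := Λ) family

attribute [instance] CKRep.inst

section Algebra

variable {k : ℕ} {Λ : Type u} [Category.{w} Λ] [KGraph k Λ]

variable (Λ) in
/-- The `ℓ^∞`-product of the C⋆-algebras of all Cuntz–Krieger families. -/
abbrev CKProduct : Type (max u w (v + 1)) := lp (fun i : CKRep.{u, w, v} k Λ => i.carrier) ∞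

/-- The family in the product whose component at each Cuntz–Krieger family is that family. -/
noncomputable def productFamily : PathFamily Λ (CKProduct.{u, w, v} Λ) := fun _ _ f =>
  ⟨fun i => i.family f, memℓp_infty ⟨1, by
    rintro _ ⟨i, rfl⟩
    exact i.isCK.toIsTCK.norm_le_one f⟩⟩

variable (Λ) in
/-- `C*(Λ)` as a closed `*`-subalgebra of the product. -/
noncomputable def ckSubalgebra : NonUnitalStarSubalgebra ℂ (CKProduct.{u, w, v} Λ) :=
  (NonUnitalStarAlgebra.adjoin ℂ
    {a | ∃ (x y : Λ) (f : x ⟶ y), a = productFamily f}).topologicalClosure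

instance : IsClosed (ckSubalgebra.{u, w, v} Λ : Set (CKProduct.{u, w, v} Λ)) :=
  NonUnitalStarSubalgebra.isClosed_topologicalClosure _

variable (Λ) in
/-- The Cuntz–Krieger algebra `C*(Λ)`. -/
abbrev CKAlgebra : Type (max u w (v + 1)) := ckSubalgebra.{u, w, v} Λ

lemma productFamily_mem {x y : Λ} (f : x ⟶ y) :
    productFamily.{u, w, v} f ∈ ckSubalgebra.{u, w, v} Λ :=
  NonUnitalStarSubalgebra.le_topologicalClosure _
    (NonUnitalStarAlgebra.subset_adjoin ℂ _ ⟨x, y, f, rfl⟩)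

/-- The universal Cuntz–Krieger family `s_λ` in `C*(Λ)`. -/
noncomputable def ckFamily : PathFamily Λ (CKAlgebra.{u, w, v} Λ) := fun _ _ f =>
  ⟨productFamily f, productFamily_mem f⟩

/-- Evaluation of the product at one Cuntz–Krieger family. -/
noncomputable def productEval (i : CKRep.{u, w, v} k Λ) :
    CKProduct.{u, w, v} Λ →⋆ₙₐ[ℂ] i.carrier where
  toFun a := a i
  map_smul' _ _ := rfl
  map_zero' := rfl
  map_add' _ _ := rfl
  map_mul' _ _ := rfl
  map_star' _ := rfl

/-- The `*`-homomorphism `C*(Λ) → B` that carries `s_λ` to `q_λ`. -/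
noncomputable def ckLift {B : Type v} [NonUnitalCStarAlgebra B] (q : PathFamily Λ B)
    (hq : IsCK (Λ := Λ) q) : CKAlgebra.{u, w, v} Λ →⋆ₙₐ[ℂ] B :=
  (productEval ⟨B, q, hq⟩).comp (NonUnitalStarSubalgebraClass.subtype (ckSubalgebra Λ))

lemma ckLift_ckFamily {B : Type v} [NonUnitalCStarAlgebra B] (q : PathFamily Λ B)
    (hq : IsCK (Λ := Λ) q) {x y : Λ} (f : x ⟶ y) : ckLift q hq (ckFamily f) = q f := rfl

lemma isCK_ckFamily [FinitelyAligned Λ] :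
    IsCK (Λ := Λ) (A := CKAlgebra.{u, w, v} Λ) ckFamily := by
  refine IsCK.of_jointly_injective
    (fun i : CKRep.{u, w, v} k Λ => (ckLift (Λ := Λ) i.family i.isCK)) ?_ _ ?_
  · intro a b h
    refine Subtype.ext (lp.ext (funext fun i => h i))
  · exact fun i => i.isCK

/-- `C*(Λ)` is generated by the universal family. -/
lemma adjoin_ckFamily : (NonUnitalStarAlgebra.adjoin ℂ
    {a : CKAlgebra.{u, w, v} Λ | ∃ (x y : Λ) (f : x ⟶ y), a = ckFamily f}).topologicalClosure
      = ⊤ := by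
  rw [eq_top_iff]
  rintro a -
  show a ∈ closure _
  rw [closure_subtype]
  refine closure_mono ?_ a.2
  set T := NonUnitalStarAlgebra.adjoin ℂ
    {a : CKAlgebra.{u, w, v} Λ | ∃ (x y : Λ) (f : x ⟶ y), a = ckFamily f}
  have h : NonUnitalStarAlgebra.adjoin ℂ
      {a : CKProduct.{u, w, v} Λ | ∃ (x y : Λ) (f : x ⟶ y), a = productFamily f} ≤
      T.map (NonUnitalStarSubalgebraClass.subtype (ckSubalgebra.{u, w, v} Λ)) := by
    refine NonUnitalStarAlgebra.adjoin_le ?_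
    rintro _ ⟨x, y, f, rfl⟩
    exact ⟨ckFamily f, NonUnitalStarAlgebra.subset_adjoin ℂ _ ⟨x, y, f, rfl⟩, rfl⟩
  exact h

/-! ### The gauge action -/

section Gauge

variable [FinitelyAligned Λ]

/-- The action of `z ∈ 𝕋^k` on Cuntz–Krieger families. -/
noncomputable def CKRep.twist (z : Fin k → Circle) (i : CKRep.{u, w, v} k Λ) :
    CKRep.{u, w, v} k Λ :=
  ⟨i.carrier, KGraphAlgebra.twist z i.family, i.isCK.twist z⟩

/-- The action of `z` on the product, by reindexing along the action on families. -/
noncomputable def productGauge (z : Fin k → Circle) :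
    CKProduct.{u, w, v} Λ →⋆ₙₐ[ℂ] CKProduct.{u, w, v} Λ where
  toFun a := ⟨fun i => a (i.twist z), memℓp_infty ⟨‖a‖, by
    rintro _ ⟨i, rfl⟩
    exact lp.norm_apply_le_norm ENNReal.top_ne_zero a (i.twist z)⟩⟩
  map_smul' _ _ := rfl
  map_zero' := rfl
  map_add' _ _ := rfl
  map_mul' _ _ := rfl
  map_star' _ := rfl

lemma productGauge_productFamily (z : Fin k → Circle) {x y : Λ} (f : x ⟶ y) :
    productGauge z (productFamily.{u, w, v} f) =
      (torusPow z (KGraph.deg f) : ℂ) • productFamily f := rfl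

lemma ckSubalgebra_le_comap (z : Fin k → Circle) :
    ckSubalgebra.{u, w, v} Λ ≤ (ckSubalgebra.{u, w, v} Λ).comap (productGauge z) := by
  refine NonUnitalStarSubalgebra.topologicalClosure_minimal _ ?_ ?_
  · refine NonUnitalStarAlgebra.adjoin_le ?_
    rintro _ ⟨x, y, f, rfl⟩
    show productGauge z (productFamily f) ∈ ckSubalgebra Λ
    rw [productGauge_productFamily]
    exact SMulMemClass.smul_mem _ (productFamily_mem f)
  · refine NonUnitalStarSubalgebra.isClosed_topologicalClosure _ |>.preimage
      (f := productGauge z) ?_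
    refine AddMonoidHomClass.continuous_of_bound (productGauge z) 1 fun a => ?_
    rw [one_mul]
    refine lp.norm_le_of_forall_le (norm_nonneg a) fun i => ?_
    exact lp.norm_apply_le_norm ENNReal.top_ne_zero a (i.twist z)

/-- The gauge automorphism `γ_z` of `C*(Λ)`. -/
noncomputable def gauge (z : Fin k → Circle) :
    CKAlgebra.{u, w, v} Λ →⋆ₙₐ[ℂ] CKAlgebra.{u, w, v} Λ :=
  NonUnitalStarAlgHom.codRestrict
    ((productGauge z).comp (NonUnitalStarSubalgebraClass.subtype (ckSubalgebra Λ)))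
    (ckSubalgebra Λ) fun a => ckSubalgebra_le_comap z a.2

lemma gauge_ckFamily (z : Fin k → Circle) {x y : Λ} (f : x ⟶ y) :
    gauge z (ckFamily.{u, w, v} f) = (torusPow z (KGraph.deg f) : ℂ) • ckFamily f := rfl

end Gauge

/-! ### Ideals of the Cuntz–Krieger algebra

As usual, ideals of C⋆-algebras are closed and two-sided (by approximate units, a closed two-sided
ring ideal is then automatically a linear subspace). -/

/-- The (closed, two-sided) ideal of a C⋆-algebra generated by a set. -/
def closedIdealSpan {A : Type v} [NonUnitalCStarAlgebra A] (S : Set A) : TwoSidedIdeal A :=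
  sInf {K | IsClosed (K : Set A) ∧ S ⊆ K}

/-- `I` is invariant under the gauge action. -/
def IsGaugeInvariant [FinitelyAligned Λ] (I : TwoSidedIdeal (CKAlgebra.{u, w, v} Λ)) : Prop :=
  ∀ (z : Fin k → Circle), ∀ a ∈ I, gauge z a ∈ I

/-- `H_I`, the set of vertices `v` with `s_v ∈ I`. -/
def idealVertices (I : TwoSidedIdeal (CKAlgebra.{u, w, v} Λ)) : Set Λ :=
  {v | ckFamily (𝟙 v) ∈ I}

/-- `H_I` is hereditary, so that `Λ \ ΛH_I` is a `k`-graph with vertex set `Λ⁰ \ H_I`. -/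
lemma idealVertices_hereditary [FinitelyAligned Λ] (I : TwoSidedIdeal (CKAlgebra.{u, w, v} Λ))
    {x y : Λ} (f : x ⟶ y) (hy : y ∈ idealVertices I) : x ∈ idealVertices I := by
  have hck := (isCK_ckFamily.{u, w, v} (Λ := Λ)).toIsTCK
  have h : ckFamily.{u, w, v} (𝟙 x) = star (ckFamily f) * (ckFamily (𝟙 y) * ckFamily f) := by
    rw [hck.mul, Category.comp_id, hck.star_mul_self]
  show ckFamily.{u, w, v} (𝟙 x) ∈ I
  rw [h]
  exact I.mul_mem_left _ _ (I.mul_mem_right _ _ hy)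

/-- `B_I`, the sets `E ∈ FE(Λ \ ΛH_I)` with `Δ(s)^E ∈ I`, each bundled with its range `r(E)`. -/
def idealFE (I : TwoSidedIdeal (CKAlgebra.{u, w, v} Λ)) :
    Set ((v : Λ) × Finset (PathsTo v)) :=
  {E | IsFE (idealVertices I) E.1 E.2 ∧ Delta ckFamily E.1 E.2 ∈ I}

/-- `B̃_I`, the sets in `B_I` that consist of edges. -/
def idealEdgeFE (I : TwoSidedIdeal (CKAlgebra.{u, w, v} Λ)) :
    Set ((v : Λ) × Finset (PathsTo v)) :=
  {E ∈ idealFE I | ∀ lam ∈ E.2, IsEdge lam.2}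

/-- The elements `Δ(s)^E` of `C*(Λ)`, where `E` ranges over the collection `𝓔`. -/
def gapElements (𝓔 : Set ((v : Λ) × Finset (PathsTo v))) : Set (CKAlgebra.{u, w, v} Λ) :=
  {a | ∃ E ∈ 𝓔, a = Delta ckFamily E.1 E.2}

/-- The vertex projections `s_v` with `v ∈ H`. -/
def vertexProjections (H : Set Λ) : Set (CKAlgebra.{u, w, v} Λ) :=
  {a | ∃ v ∈ H, a = ckFamily (𝟙 v)}

end Algebra

end KGraphAlgebra

/-!
Let `H` be the hereditary set of vertices `v` with `q_v ∈ I`. The passage from the sets `E` in `B_I`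
to sets of edges rests on one absorption principle (`mem_of_Delta_mul_mem`): since `q_v - Δ(q)^E`
lies in the left ideal generated by the `q_λ^*`, `λ ∈ E`, an element `a = q_v a` belongs to a
two-sided ideal as soon as `Δ(q)^E a` and all `q_λ^* a`, `λ ∈ E`, do.

Choose an initial edge of each path of `E`, and let `F` be the set of these edges. It is again
exhaustive in `Λ \ ΛH`, and `q_λ^* Δ(q)^F = 0` for all `λ ∈ E`, so that absorption along `E` gives
`Δ(q)^F ∈ I` (`exists_initialEdges`, `IsTCK.Delta_initialEdges_mem`). Thus `Δ(q)^F` is one of the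
generators of `J`, and absorption along `F` reduces `Δ(q)^E ∈ J` to `q_e^* Δ(q)^E ∈ J` for `e ∈ F`.

If `e ∈ E`, then `q_e^* Δ(q)^E = 0`. Otherwise let `G = Ext(e; E)` be the set of the paths `α` of
`Λ \ ΛH` with `(α, β) ∈ Λ^min(e, λ)` for some `λ ∈ E`. This set is in `B_I` as well: it is
exhaustive (`IsFE.extensions`), and absorption along `E` applied to `q_e Δ(q)^G` gives
`Δ(q)^G ∈ I`, where the
pairs of `Λ^min(e, λ)` with source in `H` contribute elements of `I`
(`IsTCK.Delta_extensions_mem`). The degrees of the paths in `G` have a smaller common bound than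
those of the paths in `E`, so `Δ(q)^G ∈ J` by induction, and absorption along `G` yields
`q_e^* Δ(q)^E ∈ J`, because `q_{eα}^* Δ(q)^E = q_{λβ}^* Δ(q)^E = 0` for `α ∈ G`.
-/

namespace KGraphAlgebra

/-! ### Factorisations and common extensions of paths -/

section Paths

variable {k : ℕ} {Λ : Type u} [Category.{w} Λ] [KGraph k Λ]

lemma exists_factor_of_comp_eq {a x y z : Λ} {α : z ⟶ x} {μ : x ⟶ a} {τ : z ⟶ y} {η : y ⟶ a}
    (h : α ≫ μ = τ ≫ η) (hd : KGraph.deg μ ≤ KGraph.deg η) :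
    ∃ γ : y ⟶ x, γ ≫ μ = η ∧ τ ≫ γ = α := by
  obtain ⟨⟨b, γ, μ'⟩, ⟨hμ', -, hη⟩, -⟩ :=
    KGraph.factorisation η (KGraph.deg μ) (KGraph.deg η - KGraph.deg μ)
      (add_tsub_cancel_of_le hd).symm
  dsimp only at hμ' hη
  have hdeg : KGraph.deg (α ≫ μ) = KGraph.deg μ + KGraph.deg α := KGraph.deg_comp _ _
  have hdeg' : KGraph.deg (τ ≫ γ) = KGraph.deg α := by
    have h1 : KGraph.deg (α ≫ μ) = KGraph.deg μ + KGraph.deg (τ ≫ γ) := by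
      rw [h, ← hη, ← Category.assoc, KGraph.deg_comp, hμ']
    exact (add_left_cancel (hdeg.symm.trans h1)).symm
  have := (KGraph.factorisation (α ≫ μ) _ _ hdeg).unique
    (y₁ := ⟨b, τ ≫ γ, μ'⟩) (y₂ := ⟨x, α, μ⟩)
    ⟨hμ', hdeg', by rw [Category.assoc, hη, h]⟩ ⟨rfl, rfl, rfl⟩
  obtain ⟨rfl, h2⟩ := Sigma.mk.inj this
  obtain ⟨h3, h4⟩ := Prod.mk.inj (eq_of_heq h2)
  exact ⟨γ, by rw [← h4, hη], h3⟩

/-- Every common extension of two paths factors through a minimal one. -/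
lemma exists_minExt_of_comp_eq {a x y z : Λ} {α : z ⟶ x} {μ : x ⟶ a} {β : z ⟶ y} {ν : y ⟶ a}
    (h : α ≫ μ = β ≫ ν) :
    ∃ p ∈ minExt μ ν, ∃ τ : z ⟶ p.1, τ ≫ p.2.1 = α ∧ τ ≫ p.2.2 = β := by
  have hle : KGraph.deg μ ⊔ KGraph.deg ν ≤ KGraph.deg (α ≫ μ) := by
    refine sup_le ?_ ?_
    · rw [KGraph.deg_comp]
      exact le_self_add
    · rw [h, KGraph.deg_comp]
      exact le_self_add
  obtain ⟨⟨b, τ, η⟩, ⟨hη, -, hτ⟩, -⟩ := KGraph.factorisation (α ≫ μ) _ _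
    (add_tsub_cancel_of_le hle).symm
  dsimp only at hη hτ
  obtain ⟨γ, hγ, hγ'⟩ := exists_factor_of_comp_eq hτ.symm (hη ▸ le_sup_left)
  obtain ⟨δ, hδ, hδ'⟩ := exists_factor_of_comp_eq (hτ.trans h).symm (hη ▸ le_sup_right)
  exact ⟨⟨b, γ, δ⟩, ⟨hγ.trans hδ.symm, by rw [hγ, hη]⟩, τ, hγ', hδ'⟩

lemma exists_initialEdge {x v : Λ} (lam : x ⟶ v) (h : KGraph.deg lam ≠ 0) :
    ∃ e : PathsTo v, IsEdge e.2 ∧ ∃ g : x ⟶ e.1, g ≫ e.2 = lam := by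
  obtain ⟨j, hj⟩ := Function.ne_iff.1 h
  have hle : Pi.single j 1 ≤ KGraph.deg lam := by
    intro i
    by_cases hi : i = j
    · subst hi
      rw [Pi.single_eq_same]
      exact Nat.one_le_iff_ne_zero.2 hj
    · rw [Pi.single_eq_of_ne hi]
      exact Nat.zero_le _
  obtain ⟨⟨b, g, e⟩, ⟨he, -, hg⟩, -⟩ := KGraph.factorisation lam _ _
    (add_tsub_cancel_of_le hle).symm
  exact ⟨⟨b, e⟩, ⟨j, he⟩, g, hg⟩

lemma IsFE.deg_ne_zero {H : Set Λ} {v : Λ} {E : Finset (PathsTo v)} (hE : IsFE H v E)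
    {lam : PathsTo v} (hlam : lam ∈ E) : KGraph.deg lam.2 ≠ 0 := fun h => by
  have := eq_id_of_deg_eq_zero lam.2 h
  exact hE.id_notMem (this ▸ hlam)

/-- Initial edges of the paths in an exhaustive set again form an exhaustive set. -/
lemma exists_initialEdges {H : Set Λ} (hH : ∀ {x y : Λ}, (x ⟶ y) → y ∈ H → x ∈ H) {v : Λ}
    {E : Finset (PathsTo v)} (hE : IsFE H v E) :
    ∃ F : Finset (PathsTo v), IsFE H v F ∧
      (∀ e ∈ F, IsEdge e.2 ∧ ∃ lam ∈ E, ∃ g : lam.1 ⟶ e.1, g ≫ e.2 = lam.2) ∧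
      ∀ lam ∈ E, ∃ e ∈ F, ∃ g : lam.1 ⟶ e.1, g ≫ e.2 = lam.2 := by
  classical
  choose e he g hg using fun lam : E => exists_initialEdge lam.1.2 (hE.deg_ne_zero lam.2)
  refine ⟨Finset.univ.image e, ⟨hE.vertex_notMem, ?_, ?_, ?_⟩, ?_, ?_⟩
  · intro f hf
    obtain ⟨lam, -, rfl⟩ := Finset.mem_image.1 hf
    exact fun h => hE.source_notMem _ lam.2 (hH (g lam) h)
  · intro hf
    obtain ⟨lam, -, hlam⟩ := Finset.mem_image.1 hf
    obtain ⟨j, hj⟩ := he lam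
    rw [hlam, KGraph.deg_id] at hj
    simpa using congrFun hj j
  · intro μ hμ
    obtain ⟨lam, hlam, p, hp, hpH⟩ := hE.exhaustive μ hμ
    have h : p.2.1 ≫ μ.2 = (p.2.2 ≫ g ⟨lam, hlam⟩) ≫ (e ⟨lam, hlam⟩).2 := by
      rw [Category.assoc, hg, hp.1]
    obtain ⟨r, hr, τ, -⟩ := exists_minExt_of_comp_eq h
    exact ⟨_, Finset.mem_image_of_mem e (Finset.mem_univ _), r, hr, fun h' => hpH (hH τ h')⟩
  · intro f hf
    obtain ⟨lam, -, rfl⟩ := Finset.mem_image.1 hf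
    exact ⟨he lam, lam.1, lam.2, g lam, hg lam⟩
  · exact fun lam hlam =>
      ⟨_, Finset.mem_image_of_mem e (Finset.mem_univ _), g ⟨lam, hlam⟩, hg ⟨lam, hlam⟩⟩

lemma finite_extensions [FinitelyAligned Λ] (H : Set Λ) {v x : Λ} (e : x ⟶ v)
    (E : Finset (PathsTo v)) :
    {γ : PathsTo x | γ.1 ∉ H ∧ ∃ lam ∈ E, ∃ β : γ.1 ⟶ lam.1,
      (⟨γ.1, γ.2, β⟩ : (z : Λ) × (z ⟶ x) × (z ⟶ lam.1)) ∈ minExt e lam.2}.Finite := by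
  have h (lam : PathsTo v) :
      ((fun p => (⟨p.1, p.2.1⟩ : PathsTo x)) '' minExt e lam.2).Finite :=
    (FinitelyAligned.finite_minExt e lam.2).image _
  refine (E.finite_toSet.biUnion fun lam _ => h lam).subset ?_
  rintro γ ⟨-, lam, hlam, β, hβ⟩
  exact Set.mem_biUnion hlam ⟨_, hβ, rfl⟩

/-- `Ext(e; E)` in `Λ \ ΛH`: the paths `α` with source outside `H` for which there are `λ ∈ E` and
`β` with `(α, β) ∈ Λ^min(e, λ)`. -/
noncomputable def extensions [FinitelyAligned Λ] (H : Set Λ) {v x : Λ} (e : x ⟶ v)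
    (E : Finset (PathsTo v)) : Finset (PathsTo x) :=
  (finite_extensions H e E).toFinset

lemma mem_extensions [FinitelyAligned Λ] {H : Set Λ} {v x : Λ} {e : x ⟶ v}
    {E : Finset (PathsTo v)} {γ : PathsTo x} :
    γ ∈ extensions H e E ↔ γ.1 ∉ H ∧ ∃ lam ∈ E, ∃ β : γ.1 ⟶ lam.1,
      (⟨γ.1, γ.2, β⟩ : (z : Λ) × (z ⟶ x) × (z ⟶ lam.1)) ∈ minExt e lam.2 :=
  Set.Finite.mem_toFinset _

lemma IsFE.extensions [FinitelyAligned Λ] {H : Set Λ}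
    (hH : ∀ {x y : Λ}, (x ⟶ y) → y ∈ H → x ∈ H) {v : Λ} {E : Finset (PathsTo v)}
    (hE : IsFE H v E) {e : PathsTo v} (heH : e.1 ∉ H) (he : IsEdge e.2) (heE : e ∉ E) :
    IsFE H e.1 (extensions H e.2 E) where
  vertex_notMem := heH
  source_notMem _ h := (mem_extensions.1 h).1
  id_notMem h := by
    obtain ⟨-, lam, hlam, β, h1, h2⟩ := mem_extensions.1 h
    dsimp only at β h1 h2
    rw [Category.id_comp] at h1 h2
    obtain ⟨j, hj⟩ := he
    -- `e = λβ` is an edge and `λ` is not a vertex, so `β` is a vertex and `e = λ`.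
    have hβ : KGraph.deg β = 0 := by
      have h3 : Pi.single j 1 = KGraph.deg lam.2 + KGraph.deg β := by
        rw [← hj, h1, KGraph.deg_comp]
      have h4 : ∀ i, i ≠ j → KGraph.deg lam.2 i = 0 ∧ KGraph.deg β i = 0 := fun i hi => by
        have := congrFun h3 i
        rw [Pi.single_eq_of_ne hi, Pi.add_apply] at this
        omega
      have h5 := congrFun h3 j
      rw [Pi.single_eq_same, Pi.add_apply] at h5
      have h6 : KGraph.deg lam.2 j ≠ 0 := fun h6 => hE.deg_ne_zero hlam <| by
        funext i
        by_cases hi : i = j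
        · exact hi ▸ h6
        · exact (h4 i hi).1
      funext i
      by_cases hi : i = j
      · subst hi
        show KGraph.deg β i = 0
        omega
      · exact (h4 i hi).2
    have h7 := eq_id_of_deg_eq_zero β hβ
    obtain ⟨x, e⟩ := e
    obtain ⟨y, lam⟩ := lam
    dsimp only at *
    obtain ⟨rfl, h8⟩ := Sigma.mk.inj h7
    obtain rfl := eq_of_heq h8
    rw [Category.id_comp] at h1
    exact heE (h1 ▸ hlam)
  exhaustive μ hμ := by
    obtain ⟨lam, hlam, p, hp, hpH⟩ := hE.exhaustive ⟨μ.1, μ.2 ≫ e.2⟩ hμ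
    have h : (p.2.1 ≫ μ.2) ≫ e.2 = p.2.2 ≫ lam.2 := by rw [Category.assoc]; exact hp.1
    obtain ⟨r, hr, τ, hτ, -⟩ := exists_minExt_of_comp_eq h
    obtain ⟨r', hr', τ', -⟩ := exists_minExt_of_comp_eq hτ.symm
    exact ⟨⟨r.1, r.2.1⟩, mem_extensions.2 ⟨fun h' => hpH (hH τ h'), lam, hlam, r.2.2, hr⟩, r', hr',
      fun h' => hpH (hH τ' h')⟩

/-- Passing from `E` to `Ext(e; E)` lowers a bound for the degrees by the degree of `e`. -/
lemma deg_le_of_mem_extensions [FinitelyAligned Λ] {H : Set Λ} {v x : Λ} {e : x ⟶ v}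
    {E : Finset (PathsTo v)} {N : Fin k → ℕ} (hN : ∀ lam ∈ E, KGraph.deg lam.2 ≤ N)
    (he : KGraph.deg e ≤ N) {γ : PathsTo x} (hγ : γ ∈ extensions H e E) :
    KGraph.deg γ.2 ≤ N - KGraph.deg e := by
  obtain ⟨-, lam, hlam, β, -, h⟩ := mem_extensions.1 hγ
  have h' : KGraph.deg e + KGraph.deg γ.2 ≤ N := by
    rw [← KGraph.deg_comp]
    exact h.le.trans (sup_le he (hN lam hlam))
  exact le_tsub_of_add_le_left h'

end Paths

/-! ### Gap projections and two-sided ideals -/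

section Ideals

variable {k : ℕ} {Λ : Type u} [Category.{w} Λ] [KGraph k Λ]
variable {A : Type v} [NonUnitalCStarAlgebra A] {q : PathFamily Λ A}

lemma IsTCK.id_mul (hq : IsTCK q) {x y : Λ} (f : x ⟶ y) : q (𝟙 y) * q f = q f := by
  rw [hq.mul, Category.comp_id]

lemma IsTCK.star_mul_id (hq : IsTCK q) {x y : Λ} (f : x ⟶ y) :
    star (q f) * q (𝟙 y) = star (q f) := by
  have := congrArg star (hq.id_mul f)
  rwa [StarMul.star_mul, (hq.isStarProjection y).2.star_eq] at this

lemma IsTCK.id_mul_star (hq : IsTCK q) {x y : Λ} (f : x ⟶ y) :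
    q (𝟙 x) * star (q f) = star (q f) := by
  have h : q f * q (𝟙 x) = q f := by rw [hq.mul, Category.id_comp]
  have := congrArg star h
  rwa [StarMul.star_mul, (hq.isStarProjection x).2.star_eq] at this

lemma IsTCK.star_comp (hq : IsTCK q) {x y z : Λ} (ν : x ⟶ y) (μ : y ⟶ z) :
    star (q (ν ≫ μ)) = star (q ν) * star (q μ) := by
  rw [← hq.mul, StarMul.star_mul]

lemma IsTCK.id_mul_Delta (hq : IsTCK q) (v : Λ) (E : Finset (PathsTo v)) :
    q (𝟙 v) * Delta q v E = Delta q v E := by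
  unfold Delta
  cases E.toList with
  | nil => exact (hq.isStarProjection v).1.eq
  | cons lam l =>
    rw [List.foldr_cons, ← mul_assoc, mul_sub, (hq.isStarProjection v).1.eq, ← mul_assoc,
      hq.id_mul]

lemma IsTCK.star_mul_Delta [FinitelyAligned Λ] (hq : IsTCK q) {v : Λ} {E : Finset (PathsTo v)}
    {lam : PathsTo v} (hlam : lam ∈ E) : star (q lam.2) * Delta q v E = 0 := by
  classical
  rw [← foldr_eq_Delta hq v E _ (List.perm_cons_erase (Finset.mem_toList.2 hlam)).symm,
    List.foldr_cons, ← mul_assoc, mul_sub, hq.star_mul_id, ← mul_assoc, hq.star_mul_self,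
    hq.id_mul_star, sub_self, zero_mul]

/-- Absorption: modulo the left ideal generated by the `q_λ^*`, `λ ∈ E`, the projection `Δ(q)^E`
equals `q_v`. -/
lemma mem_of_Delta_mul_mem (K : TwoSidedIdeal A) {v : Λ}
    {E : Finset (PathsTo v)} {a : A} (ha : q (𝟙 v) * a = a) (hΔ : Delta q v E * a ∈ K)
    (h : ∀ lam ∈ E, star (q lam.2) * a ∈ K) : a ∈ K := by
  have key : ∀ l : List (PathsTo v), (∀ lam ∈ l, star (q lam.2) * a ∈ K) →
      l.foldr (fun lam b => (q (𝟙 v) - q lam.2 * star (q lam.2)) * b) (q (𝟙 v)) * a - a ∈ K := by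
    intro l
    induction l with
    | nil =>
      intro _
      rw [List.foldr_nil, ha, sub_self]
      exact K.zero_mem
    | cons lam l ih =>
      intro hl
      have h1 := ih fun μ hμ => hl μ (List.mem_cons_of_mem _ hμ)
      have h2 := K.mul_mem_left (q lam.2) _ (hl lam List.mem_cons_self)
      rw [List.foldr_cons]
      set b := l.foldr (fun lam b => (q (𝟙 v) - q lam.2 * star (q lam.2)) * b) (q (𝟙 v))
      have h3 : (q (𝟙 v) - q lam.2 * star (q lam.2)) * b * a - a =
          (q (𝟙 v) - q lam.2 * star (q lam.2)) * (b * a - a) -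
            q lam.2 * (star (q lam.2) * a) := by
        rw [mul_sub, sub_mul _ _ a, ha, mul_assoc, mul_assoc (q lam.2)]
        abel
      rw [h3]
      exact K.sub_mem (K.mul_mem_left _ _ h1) h2
  have := K.sub_mem hΔ (key E.toList fun lam hlam => h lam (Finset.mem_toList.1 hlam))
  rwa [← Delta, sub_sub_cancel] at this

/-- If every path of `E` extends a path of `F`, then `Δ(q)^F ≤ Δ(q)^E`, and so `Δ(q)^F` lies in
every ideal that contains `Δ(q)^E`. -/
lemma IsTCK.Delta_initialEdges_mem [FinitelyAligned Λ] (hq : IsTCK q) (I : TwoSidedIdeal A)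
    {v : Λ} {E F : Finset (PathsTo v)}
    (hEF : ∀ lam ∈ E, ∃ e ∈ F, ∃ g : lam.1 ⟶ e.1, g ≫ e.2 = lam.2) (hE : Delta q v E ∈ I) :
    Delta q v F ∈ I := by
  refine mem_of_Delta_mul_mem I (hq.id_mul_Delta v F) (I.mul_mem_right _ _ hE) ?_
  intro lam hlam
  obtain ⟨e, he, g, hg⟩ := hEF lam hlam
  rw [← hg, hq.star_comp, mul_assoc, hq.star_mul_Delta he, mul_zero]
  exact I.zero_mem

lemma IsTCK.Delta_extensions_mem [FinitelyAligned Λ] (hq : IsTCK q) (I : TwoSidedIdeal A)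
    {H : Set Λ} (hHI : ∀ x ∈ H, q (𝟙 x) ∈ I) {v x : Λ} (e : x ⟶ v) {E : Finset (PathsTo v)}
    (hE : Delta q v E ∈ I) : Delta q x (extensions H e E) ∈ I := by
  set D := Delta q x (extensions H e E) with hD
  have h : q e * D ∈ I := by
    refine mem_of_Delta_mul_mem I (E := E) (by rw [← mul_assoc, hq.id_mul])
      (I.mul_mem_right _ _ hE) fun lam hlam => ?_
    have hfin : (minExt e lam.2).Finite := FinitelyAligned.finite_minExt e lam.2
    -- `q_λ^* q_e = ∑ q_β q_α^*` over `Λ^min(e, λ)`, and `q_α^* Δ(q)^G` vanishes for `α ∈ G`.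
    have hsum : star (q lam.2) * q e = ∑ p ∈ hfin.toFinset, q p.2.2 * star (q p.2.1) := by
      have := congrArg star (hq.tck3 e lam.2)
      rw [finsum_mem_eq_finite_toFinset_sum _ hfin, star_sum] at this
      simpa only [StarMul.star_mul, star_star] using this
    rw [← mul_assoc, hsum, Finset.sum_mul]
    refine sum_mem fun p hp => ?_
    have hp' := hfin.mem_toFinset.1 hp
    rw [mul_assoc]
    refine I.mul_mem_left _ _ ?_
    by_cases hpH : p.1 ∈ H
    · rw [← hq.id_mul_star]
      exact I.mul_mem_right _ _ (I.mul_mem_right _ _ (hHI _ hpH))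
    · have hmem : (⟨p.1, p.2.1⟩ : PathsTo x) ∈ extensions H e E :=
        mem_extensions.2 ⟨hpH, lam, hlam, p.2.2, hp'⟩
      rw [hD, hq.star_mul_Delta hmem]
      exact I.zero_mem
  have h' := I.mul_mem_left (star (q e)) _ h
  rwa [← mul_assoc, hq.star_mul_self, hq.id_mul_Delta] at h'

/-- If the ideal `K` contains `Δ(q')^F` for all finite exhaustive sets `F` of edges with
`Δ(q)^F ∈ I`, then it contains `Δ(q')^E` for all finite exhaustive sets `E` with `Δ(q)^E ∈ I`. The
two families may live in different algebras. -/
theorem IsTCK.Delta_mem_of_edges [FinitelyAligned Λ] {B : Type v'} [NonUnitalCStarAlgebra B]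
    {q' : PathFamily Λ B} (hq : IsTCK q) (hq' : IsTCK q') (I : TwoSidedIdeal A)
    (K : TwoSidedIdeal B)
    {H : Set Λ} (hH : ∀ {x y : Λ}, (x ⟶ y) → y ∈ H → x ∈ H) (hHI : ∀ x ∈ H, q (𝟙 x) ∈ I)
    (hK : ∀ (v : Λ) (F : Finset (PathsTo v)), IsFE H v F → Delta q v F ∈ I →
      (∀ e ∈ F, IsEdge e.2) → Delta q' v F ∈ K)
    {v : Λ} {E : Finset (PathsTo v)} (hE : IsFE H v E) (hEI : Delta q v E ∈ I) :
    Delta q' v E ∈ K := by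
  obtain ⟨N, hN⟩ : ∃ N : Fin k → ℕ, ∀ lam ∈ E, KGraph.deg lam.2 ≤ N :=
    ⟨E.sup fun lam => KGraph.deg lam.2, fun lam hlam =>
      Finset.le_sup (f := fun lam : PathsTo v => KGraph.deg lam.2) hlam⟩
  induction N using WellFoundedLT.induction generalizing v with
  | ind N ih =>
    obtain ⟨F, hF, hFE, hEF⟩ := exists_initialEdges hH hE
    have hFK := hK v F hF (hq.Delta_initialEdges_mem I hEF hEI) fun e he => (hFE e he).1
    refine mem_of_Delta_mul_mem K (hq'.id_mul_Delta v E) (K.mul_mem_right _ _ hFK) ?_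
    intro e he
    by_cases heE : e ∈ E
    · rw [hq'.star_mul_Delta heE]
      exact K.zero_mem
    obtain ⟨hedge, lam, hlam, g, hg⟩ := hFE e he
    have heN : KGraph.deg e.2 ≤ N := by
      refine le_trans ?_ (hN lam hlam)
      rw [← hg, KGraph.deg_comp]
      exact le_self_add
    have hlt : N - KGraph.deg e.2 < N := by
      obtain ⟨j, hj⟩ := hedge
      refine lt_of_le_of_ne tsub_le_self fun h => ?_
      have h1 : N j - KGraph.deg e.2 j = N j := congrFun h j
      have h2 : KGraph.deg e.2 j ≤ N j := heN j
      rw [hj, Pi.single_eq_same] at h1 h2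
      omega
    have hG := ih _ hlt (hE.extensions hH (hF.source_notMem e he) hedge heE)
      (hq.Delta_extensions_mem I hHI e.2 hEI) fun γ hγ => deg_le_of_mem_extensions hN heN hγ
    refine mem_of_Delta_mul_mem K (by rw [← mul_assoc, hq'.id_mul_star])
      (K.mul_mem_right _ _ hG) fun γ hγ => ?_
    -- `eγ = λβ` with `λ ∈ E`, and `q'_λ^*` annihilates `Δ(q')^E`.
    obtain ⟨-, μ, hμ, β, hβ, -⟩ := mem_extensions.1 hγ
    dsimp only at hβ
    rw [← mul_assoc, ← hq'.star_comp, hβ, hq'.star_comp, mul_assoc, hq'.star_mul_Delta hμ, mul_zero]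
    exact K.zero_mem

end Ideals

/-! ### Generated closed ideals -/

lemma mem_closedIdealSpan {A : Type v} [NonUnitalCStarAlgebra A] {S : Set A} {a : A} :
    a ∈ closedIdealSpan S ↔ ∀ K : TwoSidedIdeal A, IsClosed (K : Set A) → S ⊆ K → a ∈ K := by
  rw [closedIdealSpan, TwoSidedIdeal.mem_sInf]
  exact ⟨fun h K hK hS => h K ⟨hK, hS⟩, fun h K hK => h K hK.1 hK.2⟩

/-- The ideal `I` enters only through the collections `B_I` and `B̃_I` of sets of paths, so `I` and
`K` may be ideals of copies of `C*(Λ)` built in different universes. This is needed, because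
`gapElements 𝓔` does not determine the universe of the C⋆-algebras in the construction. -/
lemma Delta_ckFamily_mem {k : ℕ} {Λ : Type u} [Category.{w} Λ] [KGraph k Λ] [FinitelyAligned Λ]
    (I : TwoSidedIdeal (CKAlgebra.{u, w, v} Λ)) (K : TwoSidedIdeal (CKAlgebra.{u, w, v'} Λ))
    (hK : gapElements (idealEdgeFE I) ⊆ (K : Set (CKAlgebra.{u, w, v'} Λ)))
    {E : (v : Λ) × Finset (PathsTo v)} (hE : E ∈ idealFE I) : Delta ckFamily E.1 E.2 ∈ K :=
  isCK_ckFamily.toIsTCK.Delta_mem_of_edges isCK_ckFamily.toIsTCK I K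
    (idealVertices_hereditary I) (fun _ hx => hx)
    (fun v F hF hFI hedge => hK ⟨⟨v, F⟩, ⟨⟨hF, hFI⟩, hedge⟩, rfl⟩) hE.1 hE.2

end KGraphAlgebra

theorem mainTheorem8 {k : ℕ} {Λ : Type u} [Category.{w} Λ] [KGraphAlgebra.KGraph k Λ]
    [KGraphAlgebra.FinitelyAligned Λ]
    (I : TwoSidedIdeal (KGraphAlgebra.CKAlgebra.{u, w, v} Λ))
    (hI : IsClosed (I : Set (KGraphAlgebra.CKAlgebra.{u, w, v} Λ)))
    (hgauge : KGraphAlgebra.IsGaugeInvariant I) :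
    (∀ E ∈ KGraphAlgebra.idealFE I,
      KGraphAlgebra.Delta KGraphAlgebra.ckFamily E.1 E.2 ∈
        KGraphAlgebra.closedIdealSpan
          (KGraphAlgebra.gapElements (KGraphAlgebra.idealEdgeFE I))) ∧
    KGraphAlgebra.closedIdealSpan
        (KGraphAlgebra.vertexProjections (KGraphAlgebra.idealVertices I) ∪
          KGraphAlgebra.gapElements (KGraphAlgebra.idealFE I)) =
      KGraphAlgebra.closedIdealSpan
        (KGraphAlgebra.vertexProjections (KGraphAlgebra.idealVertices I) ∪
          KGraphAlgebra.gapElements (KGraphAlgebra.idealEdgeFE I)) := by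
  refine ⟨fun E hE => KGraphAlgebra.mem_closedIdealSpan.2 fun K _ hK =>
    KGraphAlgebra.Delta_ckFamily_mem I K hK hE, ?_⟩
  refine le_antisymm (fun a ha => ?_) (fun a ha => ?_)
  · refine KGraphAlgebra.mem_closedIdealSpan.2 fun K hK hS => ?_
    refine KGraphAlgebra.mem_closedIdealSpan.1 ha K hK (Set.union_subset ?_ ?_)
    · exact Set.subset_union_left.trans hS
    · rintro _ ⟨E, hE, rfl⟩
      exact KGraphAlgebra.Delta_ckFamily_mem I K (Set.subset_union_right.trans hS) hE
  · refine KGraphAlgebra.mem_closedIdealSpan.2 fun K hK hS => ?_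
    refine KGraphAlgebra.mem_closedIdealSpan.1 ha K hK
      (subset_trans (Set.union_subset_union_right _ ?_) hS)
    rintro _ ⟨E, hE, rfl⟩
    exact ⟨E, hE.1, rfl⟩
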